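/- Let $F$ be a field of characteristic different from $2$ such that $|F^\ast/F^{\ast 2}|=2^d$ for some integer $d\ge 0$, and let $n\ge 1$ be an integer. Notation. Let $W(F)$ be the Witt ring of $F$, let $IF\subseteq W(F)$ be the ideal of Witt classes of even-dimensional forms, and let $I^nF$ be its $n$-th power. Let $GP_nF$ be the set of quadratic forms similar to an $n$-fold Pfister form $\langle 1,a_1\rangle\otimes\cdots\otimes\langle 1,a_n\rangle$ with $a_1,\dots,a_n\in F^\ast$. For $\varphi\in I^nF$ let $\mathrm{sl}_n(\varphi)$ be the least integer $k\ge 0$ for which there are $\pi_1,\dots,\pi_k\in GP_nF$ with $\varphi\equiv\pi_1+\cdots+\pi_k \bmod I^{n+1}F$, and put $\mathrm{sl}_n(F)=\sup_{\varphi\in I^nF}\mathrm{sl}_n(\varphi)$. For $m\ge 0$ let $D_F(2^m)$ be the group of nonzero elements of $F$ that are sums of $2^m$ squares, let $\pm D_F(2^m)=D_F(2^m)\cup -D_F(2^m)$, and let $d_m=\dim_{\mathbb F_2} F^\ast/{\pm D_F(2^m)}$. The level $s(F)$ is the least $k$ such that $-1$ is a sum of $k$ squares in $F$; it is a power of $2$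 if $F$ is nonreal. (a) If $F$ is nonreal with $s(F)=2^s$, then $$\mathrm{sl}_n(F)\le\sum_{m=0}^{\min\{s,n-1\}}\ \sum_{r=0}^{\lfloor (n-m-1)/2\rfloor}\binom{\lfloor d_m/2\rfloor}{2r}\binom{\lfloor (d_m+1)/2\rfloor}{n-m-1-2r}.$$ (b) If $F$ is formally real, then $$\mathrm{sl}_n(F)\le\sum_{m=0}^{n-1}\ \sum_{r=0}^{\lfloor (n-m-1)/2\rfloor}\binom{\lfloor d_m/2\rfloor}{2r}\binom{\lfloor (d_m+1)/2\rfloor}{n-m-1-2r}.$$ -/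

import Mathlib

namespace SymbolLength

/-! ### Quadratic forms and the Witt ring

Over a field of characteristic different from `2` every nondegenerate quadratic form of
dimension `k` is isometric to a diagonal form `⟨a₁, …, aₖ⟩` with nonzero entries (see
`QuadraticForm.equivalent_weightedSumSquares_units_of_nondegenerate'`), so forms are given by
their diagonal entries. -/

noncomputable section

variable (F : Type*) [Field F]

/-- The diagonal quadratic form `⟨a₁, …, aₖ⟩`. -/
def diagForm {k : ℕ} (a : Fin k → Fˣ) : QuadraticForm F (Fin k → F) :=
  QuadraticMap.weightedSumSquares F (fun i => (a i : F))

/-- The form `⟨a₁, …, aₖ⟩` as an element `[a₁] + ⋯ + [aₖ]` of the group ring `ℤ[Fˣ]`. In this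
ring, the sum and the product of two forms are the orthogonal sum and the tensor product. -/
def formalClass {k : ℕ} (a : Fin k → Fˣ) : MonoidAlgebra ℤ Fˣ :=
  ∑ i, MonoidAlgebra.of ℤ Fˣ (a i)

/-- The ideal of `ℤ[Fˣ]` generated by the differences of isometric forms (dividing by these gives
the Grothendieck ring of isometry classes of forms) and by the hyperbolic plane `⟨1, -1⟩`. The
differences `[φ] - [ψ]` of Witt equivalent forms are closed under subtraction and under
multiplication by `±[c]`, so they are exactly the elements of this ideal. Isometric forms have the
same dimension, so one `k` suffices. -/
def wittIdeal : Ideal (MonoidAlgebra ℤ Fˣ) :=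
  Ideal.span
    ({x | ∃ (k : ℕ) (a b : Fin k → Fˣ),
        (diagForm F a).Equivalent (diagForm F b) ∧ x = formalClass F a - formalClass F b} ∪
      {formalClass F ![1, -1]})

/-- The Witt ring `W(F)`: the Grothendieck ring of isometry classes of nondegenerate quadratic
forms, modulo the ideal generated by the hyperbolic plane. -/
abbrev WittRing : Type _ := MonoidAlgebra ℤ Fˣ ⧸ wittIdeal F

/-- The Witt class of the one-dimensional form `⟨a⟩`. -/
def unary (a : Fˣ) : WittRing F :=
  Ideal.Quotient.mk (wittIdeal F) (MonoidAlgebra.of ℤ Fˣ a)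

/-- The augmentation `ℤ[Fˣ] → ℤ/2`, which sends a form to its dimension modulo `2`. -/
def dimMod2Aux : MonoidAlgebra ℤ Fˣ →+* ZMod 2 :=
  (MonoidAlgebra.lift ℤ (ZMod 2) Fˣ (1 : Fˣ →* ZMod 2)).toRingHom

theorem dimMod2Aux_formalClass {k : ℕ} (a : Fin k → Fˣ) :
    dimMod2Aux F (formalClass F a) = k := by
  simp [dimMod2Aux, formalClass]

theorem dimMod2Aux_eq_zero (x : MonoidAlgebra ℤ Fˣ) (hx : x ∈ wittIdeal F) :
    dimMod2Aux F x = 0 := by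
  have h : wittIdeal F ≤ RingHom.ker (dimMod2Aux F) := by
    refine Ideal.span_le.2 ?_
    rintro y (⟨k, a, b, -, rfl⟩ | rfl)
    · simp [RingHom.mem_ker, dimMod2Aux_formalClass]
    · rw [SetLike.mem_coe, RingHom.mem_ker, dimMod2Aux_formalClass]
      rfl
  exact h hx

/-- The dimension index `W(F) → ℤ/2`. -/
def dimMod2 : WittRing F →+* ZMod 2 :=
  Ideal.Quotient.lift (wittIdeal F) (dimMod2Aux F) (dimMod2Aux_eq_zero F)

/-- The fundamental ideal `I F` of classes of even-dimensional forms; its powers are `IⁿF`. -/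
def fundamentalIdeal : Ideal (WittRing F) := RingHom.ker (dimMod2 F)

/-- The Witt class of the `n`-fold Pfister form `⟨1, a₁⟩ ⊗ ⋯ ⊗ ⟨1, aₙ⟩`. -/
def pfister {n : ℕ} (a : Fin n → Fˣ) : WittRing F := ∏ i, (unary F 1 + unary F (a i))

/-- The Witt classes of the forms that are similar to an `n`-fold Pfister form. -/
def GP (n : ℕ) : Set (WittRing F) :=
  {x | ∃ (c : Fˣ) (a : Fin n → Fˣ), x = unary F c * pfister F a}

/-- The `n`-symbol length of a Witt class: the least `k` such that the class is congruent modulo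
`Iⁿ⁺¹F` to a sum of `k` elements of `GPₙF` (and `⊤` if there is no such `k`). -/
def symbolLength (n : ℕ) (φ : WittRing F) : ℕ∞ :=
  ⨅ k ∈ {k : ℕ | ∃ π : Fin k → WittRing F, (∀ i, π i ∈ GP F n) ∧
      φ - ∑ i, π i ∈ fundamentalIdeal F ^ (n + 1)}, (k : ℕ∞)

/-- The `n`-symbol length of the field `F`. -/
def fieldSymbolLength (n : ℕ) : ℕ∞ :=
  ⨆ φ ∈ fundamentalIdeal F ^ n, symbolLength F n φ

/-! ### Sums of squares -/

/-- The level of `F`: the least `k` such that `-1` is a sum of `k` squares, or `⊤`. -/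
def level : ℕ∞ :=
  ⨅ k ∈ {k : ℕ | ∃ x : Fin k → F, (-1 : F) = ∑ i, x i ^ 2}, (k : ℕ∞)

open Matrix in
/-- A sum of `2 ^ m` squares is the multiplier of a similitude of the form `2 ^ m • ⟨1⟩`. -/
theorem exists_similitude (m : ℕ) : ∀ x : Fin (2 ^ m) → F,
    ∃ C : Matrix (Fin (2 ^ m)) (Fin (2 ^ m)) F, Cᵀ * C = (∑ i, x i ^ 2) • 1 := by
  induction m with
  | zero =>
    intro x
    refine ⟨Matrix.of fun _ _ => x 0, ?_⟩
    ext i j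
    have hi : i = 0 := Fin.fin_one_eq_zero i
    have hj : j = 0 := Fin.fin_one_eq_zero j
    subst hi hj
    simp [Matrix.mul_apply, sq]
  | succ m ih =>
    intro x
    let e : Fin (2 ^ m) ⊕ Fin (2 ^ m) ≃ Fin (2 ^ (m + 1)) :=
      finSumFinEquiv.trans (finCongr (by ring))
    have hs : ∑ i, x i ^ 2 = ∑ i, x (e (Sum.inl i)) ^ 2 + ∑ i, x (e (Sum.inr i)) ^ 2 := by
      rw [← e.sum_comp, Fintype.sum_sum_type]
    obtain ⟨A, hA⟩ := ih fun i => x (e (Sum.inl i))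
    obtain ⟨B, hB⟩ := ih fun i => x (e (Sum.inr i))
    rw [hs]
    generalize ∑ i, x (e (Sum.inl i)) ^ 2 = a at hA
    generalize ∑ i, x (e (Sum.inr i)) ^ 2 = b at hB
    suffices h : ∃ C : Matrix (Fin (2 ^ m) ⊕ Fin (2 ^ m)) (Fin (2 ^ m) ⊕ Fin (2 ^ m)) F,
        Cᵀ * C = (a + b) • 1 by
      obtain ⟨C, hC⟩ := h
      refine ⟨C.submatrix e.symm e.symm, ?_⟩
      rw [Matrix.transpose_submatrix, Matrix.submatrix_mul_equiv, hC, Matrix.submatrix_smul]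
      simp
    have comm : ∀ (a : F) (A : Matrix (Fin (2 ^ m)) (Fin (2 ^ m)) F), a ≠ 0 →
        Aᵀ * A = a • 1 → A * Aᵀ = a • 1 := by
      intro a A ha hA
      have h1 : (a⁻¹ • Aᵀ) * A = 1 := by
        rw [smul_mul, hA, smul_smul, inv_mul_cancel₀ ha, one_smul]
      have h2 := mul_eq_one_comm.1 h1
      rw [Matrix.mul_smul] at h2
      rw [← h2, smul_smul, mul_inv_cancel₀ ha, one_smul]
    have key : ∀ (a b : F) (A B : Matrix (Fin (2 ^ m)) (Fin (2 ^ m)) F), a ≠ 0 →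
        Aᵀ * A = a • 1 → Bᵀ * B = b • 1 →
        ∃ C : Matrix (Fin (2 ^ m) ⊕ Fin (2 ^ m)) (Fin (2 ^ m) ⊕ Fin (2 ^ m)) F,
          Cᵀ * C = (a + b) • 1 := by
      intro a b A B ha hA hB
      have hA' := comm a A ha hA
      obtain ⟨B, hB, hB'⟩ : ∃ B : Matrix (Fin (2 ^ m)) (Fin (2 ^ m)) F,
          Bᵀ * B = b • 1 ∧ B * Bᵀ = b • 1 := by
        by_cases hb : b = 0
        · exact ⟨0, by simp [hb], by simp [hb]⟩
        · exact ⟨B, hB, comm b B hb hB⟩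
      -- the second block column is orthogonal to the first one
      refine ⟨fromBlocks A (-(a⁻¹ • (A * (Bᵀ * Aᵀ)))) B Aᵀ, ?_⟩
      have h11 : Aᵀ * A + Bᵀ * B = (a + b) • 1 := by rw [hA, hB, add_smul]
      have h12 : Aᵀ * -(a⁻¹ • (A * (Bᵀ * Aᵀ))) + Bᵀ * Aᵀ = 0 := by
        rw [Matrix.mul_neg, Matrix.mul_smul, ← Matrix.mul_assoc, hA, smul_mul, Matrix.one_mul, smul_smul,
          inv_mul_cancel₀ ha, one_smul, neg_add_cancel]
      have h21 : (-(a⁻¹ • (A * (Bᵀ * Aᵀ))))ᵀ * A + Aᵀᵀ * B = 0 := by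
        have h := congrArg Matrix.transpose h12
        simpa [Matrix.transpose_add, Matrix.transpose_mul] using h
      have h22 : (-(a⁻¹ • (A * (Bᵀ * Aᵀ))))ᵀ * -(a⁻¹ • (A * (Bᵀ * Aᵀ))) + Aᵀᵀ * Aᵀ =
          (a + b) • 1 := by
        have h3 : (A * (Bᵀ * Aᵀ))ᵀ * (A * (Bᵀ * Aᵀ)) = (a * (b * a)) • 1 := by
          calc (A * (Bᵀ * Aᵀ))ᵀ * (A * (Bᵀ * Aᵀ)) = A * (B * (Aᵀ * A) * Bᵀ) * Aᵀ := by
                simp only [Matrix.transpose_mul, Matrix.transpose_transpose, Matrix.mul_assoc]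
            _ = (a * (b * a)) • 1 := by
                rw [hA, Matrix.mul_smul, Matrix.mul_one, smul_mul, hB', smul_smul, Matrix.mul_smul,
                  Matrix.mul_one, smul_mul, hA', smul_smul]
                congr 1
                ring
        rw [Matrix.transpose_neg, neg_mul_neg, Matrix.transpose_smul, smul_mul, Matrix.mul_smul, h3,
          Matrix.transpose_transpose, hA', smul_smul, smul_smul, ← add_smul]
        congr 1
        field_simp
        ring
      rw [fromBlocks_transpose, fromBlocks_multiply, h11, h12, h21, h22, ← fromBlocks_one,
        fromBlocks_smul, smul_zero]
    by_cases ha : a = 0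
    · by_cases hb : b = 0
      · exact ⟨0, by simp [ha, hb]⟩
      · rw [add_comm]
        exact key b a B A hb hB hA
    · exact key a b A B ha hA hB

/-- The product of two sums of `2 ^ m` squares is a sum of `2 ^ m` squares. -/
theorem sum_sq_mul_sum_sq (m : ℕ) (x y : Fin (2 ^ m) → F) :
    ∃ z : Fin (2 ^ m) → F, (∑ i, x i ^ 2) * (∑ i, y i ^ 2) = ∑ i, z i ^ 2 := by
  obtain ⟨C, hC⟩ := exists_similitude F m x
  refine ⟨C.mulVec y, ?_⟩
  have h1 : ∀ v : Fin (2 ^ m) → F, ∑ i, v i ^ 2 = v ⬝ᵥ v := fun v => by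
    simp [dotProduct, sq]
  rw [h1 (C.mulVec y), h1 y, Matrix.dotProduct_mulVec, ← Matrix.mulVec_transpose,
    Matrix.mulVec_mulVec, hC, Matrix.smul_mulVec, Matrix.one_mulVec, smul_dotProduct, smul_eq_mul]

/-- The group `D_F(2 ^ m)` of nonzero sums of `2 ^ m` squares. -/
def sumSqSubgroup (m : ℕ) : Subgroup Fˣ where
  carrier := {u | ∃ x : Fin (2 ^ m) → F, (u : F) = ∑ i, x i ^ 2}
  mul_mem' := by
    rintro u v ⟨x, hx⟩ ⟨y, hy⟩
    obtain ⟨z, hz⟩ := sum_sq_mul_sum_sq F m x y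
    exact ⟨z, by rw [Units.val_mul, hx, hy, hz]⟩
  one_mem' := ⟨fun i => if i = 0 then 1 else 0, by simp⟩
  inv_mem' := by
    rintro u ⟨x, hx⟩
    refine ⟨fun i => (u : F)⁻¹ * x i, ?_⟩
    simp only [mul_pow, ← Finset.mul_sum, ← hx, Units.val_inv_eq_inv_val]
    field_simp

/-- The group `±D_F(2 ^ m)`. -/
def pmSumSqSubgroup (m : ℕ) : Subgroup Fˣ where
  carrier := {u | u ∈ sumSqSubgroup F m ∨ -u ∈ sumSqSubgroup F m}
  mul_mem' := by
    rintro u v (hu | hu) (hv | hv)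
    · exact Or.inl (mul_mem hu hv)
    · exact Or.inr (by simpa using mul_mem hu hv)
    · exact Or.inr (by simpa using mul_mem hu hv)
    · exact Or.inl (by simpa using mul_mem hu hv)
  one_mem' := Or.inl (one_mem _)
  inv_mem' := by
    rintro u (hu | hu)
    · exact Or.inl (inv_mem hu)
    · exact Or.inr (by simpa using inv_mem hu)

theorem sq_mem_pmSumSqSubgroup (m : ℕ) (u : Fˣ) : u ^ 2 ∈ pmSumSqSubgroup F m :=
  Or.inl ⟨fun i => if i = 0 then (u : F) else 0, by simp⟩

/-- The group `Fˣ / ±D_F(2 ^ m)`, written additively. -/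
def ModPmSumSq (m : ℕ) : Type _ := Additive (Fˣ ⧸ pmSumSqSubgroup F m)

instance (m : ℕ) : AddCommGroup (ModPmSumSq F m) :=
  inferInstanceAs (AddCommGroup (Additive (Fˣ ⧸ pmSumSqSubgroup F m)))

theorem two_nsmul_modPmSumSq (m : ℕ) (x : ModPmSumSq F m) : 2 • x = 0 := by
  induction x using Additive.rec with
  | ofMul x =>
    induction x using QuotientGroup.induction_on with
    | H u =>
      exact congrArg Additive.ofMul
        ((QuotientGroup.eq_one_iff (u ^ 2)).2 (sq_mem_pmSumSqSubgroup F m u))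

/-- The group `Fˣ / ±D_F(2 ^ m)` as a vector space over the field with two elements. -/
instance (m : ℕ) : Module (ZMod 2) (ModPmSumSq F m) :=
  AddCommGroup.zmodModule (n := 2) (two_nsmul_modPmSumSq F m)

/-- The invariant `d_m`, the dimension of `Fˣ / ±D_F(2 ^ m)` over the field with two elements. -/
def dimModPm (m : ℕ) : ℕ := Module.finrank (ZMod 2) (ModPmSumSq F m)

end

end SymbolLength

/-!
In the Witt ring write `sym a` for the class of `⟨1, -a⟩`. Then `sym (-1) = 2`, the power `IᵏF` is
additively generated by the `k`-fold products of symbols, modulo the next power these products are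
additive in each square class, and `sym a * sym a = 2 * sym a`. Moreover `2ᵐ sym a = 0` for `a` in
`D(2ᵐ)`, because a sum of `2ᵐ` squares is the multiplier of a similitude of `2ᵐ⟨1⟩`
(`two_pow_mul_unary`). So modulo `2 ^ (m + 1) I ^ (k - 1) + I ^ (m + k + 1)` the products
`2ᵐ sym a₁ ⋯ sym aₖ` form an alternating `k`-linear function on the `𝔽₂`-vector space
`Fˣ / ±D(2ᵐ)` of dimension `d_m`.

It remains to see how many values are needed to write a sum of values of such a function, and this
is `isSymbolSum_two_pow_mul`. Split a basis into parts `P` and `Q` of sizes `⌊d_m / 2⌋` and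
`⌊(d_m + 1) / 2⌋`. A monomial of degree `k` in basis vectors loses one factor, chosen so that an even
number of factors from `P` is kept; all monomials that keep the same `k - 1` factors add up to a
single symbol. The number of possible kept parts is the inner sum of the theorem. The choice is
impossible only for `k` even and monomials in `P` alone. To cover those as well, the kept parts with
one factor from `Q` are treated differently: the monomials with a given set of `k - 2` factors from
`P` add up to that product times a sum of values of an alternating bilinear function, and
`⌊d_m / 2⌋` values suffice for such a sum, since in a shortest expression the arguments are linearly
independent (`exists_sum_of_mem_closure`).

An element of `Iⁿ` is thus approximated by symbols up to an element of `2 I ^ (n - 1)`, this one up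
to an element of `4 I ^ (n - 2)`, and so on (`isSymbolSum_of_mem_two_pow_mul`). The last group
`2 ^ (n - 1) I` needs one symbol, and if `-1` is a sum of `2ˢ` squares, the process stops earlier
because `2 ^ (s + 1) = 0`.
-/

namespace SymbolLength

open scoped Pointwise

/-! ### Sums of values of alternating maps -/

/-- A sum of `r + 1` values of a symmetric and alternating bimultiplicative map is a sum of `r`
values if some nonempty product of arguments lies in the radical: that relation expresses one of
the values in terms of the others, each of which can absorb its share. -/
theorem exists_shorter_sum {G M : Type*} [CommGroup G] [AddCommGroup M] (B : G → G → M)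
    (hmul : ∀ a b c, B (a * b) c = B a c + B b c) (hsymm : ∀ a b, B a b = B b a)
    (hself : ∀ a, B a a = 0) {r : ℕ} (a b : Fin (r + 1) → G)
    (T : Finset (Fin (r + 1) ⊕ Fin (r + 1))) (hT : T.Nonempty)
    (h : ∀ c, ∑ t ∈ T, B (Sum.elim a b t) c = 0) :
    ∃ a' b' : Fin r → G, ∑ i, B (a i) (b i) = ∑ i, B (a' i) (b' i) := by
  classical
  have hmul' : ∀ a b c, B a (b * c) = B a b + B a c := fun a b c => by
    rw [hsymm, hmul, hsymm b, hsymm c]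
  have htwo : ∀ a b, B a b + B a b = 0 := fun a b => by
    have h := hself (a * b)
    rwa [hmul, hmul', hmul', hself, hself, zero_add, add_zero, hsymm b a] at h
  have hsplit : ∀ (T : Finset (Fin (r + 1) ⊕ Fin (r + 1))) (f : Fin (r + 1) ⊕ Fin (r + 1) → M),
      ∑ t ∈ T, f t = ∑ i, ((if Sum.inl i ∈ T then f (Sum.inl i) else 0) +
        (if Sum.inr i ∈ T then f (Sum.inr i) else 0)) := fun T f => by
    rw [Finset.sum_add_distrib, ← Fintype.sum_sum_type (fun t => if t ∈ T then f t else 0)]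
    simp
  -- a share `B (p a + q b) c` with `p, q ∈ {0, 1}` is absorbed by `B a b`
  have absorb : ∀ (a b c : G) (p q : Prop) [Decidable p] [Decidable q], ∃ a' b',
      B a b + ((if p then B a c else 0) + (if q then B b c else 0)) = B a' b' := by
    intro a b c p q _ _
    by_cases hp : p <;> by_cases hq : q
    · refine ⟨a * b, b * c, ?_⟩
      rw [if_pos hp, if_pos hq, hmul, hmul', hmul', hself]
      abel
    · exact ⟨a, b * c, by rw [if_pos hp, if_neg hq, hmul', add_zero]⟩
    · exact ⟨a * c, b, by rw [if_neg hp, if_pos hq, hmul, zero_add, hsymm b c]⟩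
    · exact ⟨a, b, by rw [if_neg hp, if_neg hq, add_zero, add_zero]⟩
  -- pairing the relation with `b i₀` expresses `B (a i₀) (b i₀)` by values `B (a i) (b i₀)` and
  -- `B (b i) (b i₀)` with `i ≠ i₀`
  have main : ∀ (a b : Fin (r + 1) → G) (T : Finset (Fin (r + 1) ⊕ Fin (r + 1)))
      (i₀ : Fin (r + 1)), Sum.inl i₀ ∈ T → (∀ c, ∑ t ∈ T, B (Sum.elim a b t) c = 0) →
      ∃ a' b' : Fin r → G, ∑ i, B (a i) (b i) = ∑ i, B (a' i) (b' i) := by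
    intro a b T i₀ hi₀ h
    have h1 := h (b i₀)
    rw [hsplit, Fin.sum_univ_succAbove _ i₀] at h1
    simp only [Sum.elim_inl, Sum.elim_inr, if_pos hi₀, hself, ite_self, add_zero] at h1
    choose a' b' hab using fun i : Fin r => absorb (a (i₀.succAbove i)) (b (i₀.succAbove i)) (b i₀)
      (Sum.inl (i₀.succAbove i) ∈ T) (Sum.inr (i₀.succAbove i) ∈ T)
    refine ⟨a', b', ?_⟩
    rw [← Finset.sum_congr rfl fun i _ => hab i, Finset.sum_add_distrib,
      Fin.sum_univ_succAbove _ i₀, add_comm]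
    congr 1
    rw [← add_right_inj (B (a i₀) (b i₀)), h1, htwo]
  obtain ⟨i | i, hi⟩ := hT
  · exact main a b T i hi h
  · obtain ⟨a', b', hab⟩ := main b a (T.map (Equiv.sumComm _ _).toEmbedding) i
      (Finset.mem_map.2 ⟨Sum.inr i, hi, rfl⟩) fun c => by
        rw [Finset.sum_map, ← h c]
        refine Finset.sum_congr rfl fun t _ => ?_
        rcases t with t | t <;> rfl
    exact ⟨a', b', by rw [← hab]; exact Finset.sum_congr rfl fun i _ => hsymm _ _⟩

/-- If any more than `D` elements of `G` have a nonempty product in the radical, then `D / 2` values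
of a symmetric and alternating bimultiplicative map suffice. -/
theorem exists_sum_of_mem_closure {G M : Type*} [CommGroup G] [AddCommGroup M] (B : G → G → M)
    (hmul : ∀ a b c, B (a * b) c = B a c + B b c) (hsymm : ∀ a b, B a b = B b a)
    (hself : ∀ a, B a a = 0) (D : ℕ)
    (hdep : ∀ (r : ℕ) (v : Fin r ⊕ Fin r → G), D < 2 * r →
      ∃ T : Finset (Fin r ⊕ Fin r), T.Nonempty ∧ ∀ c, ∑ t ∈ T, B (v t) c = 0)
    {x : M} (hx : x ∈ AddSubgroup.closure (Set.range fun ab : G × G => B ab.1 ab.2)) :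
    ∃ r ≤ D / 2, ∃ a b : Fin r → G, x = ∑ i, B (a i) (b i) := by
  have hone : ∀ c, B 1 c = 0 := fun c => by simpa using hmul 1 1 c
  have hinv : ∀ a b, B a⁻¹ b = -B a b := fun a b => by
    rw [eq_neg_iff_add_eq_zero, ← hmul, inv_mul_cancel, hone]
  have h1 : ∃ (r : ℕ) (a b : Fin r → G), x = ∑ i, B (a i) (b i) := by
    refine AddSubgroup.closure_induction ?_ ⟨0, Fin.elim0, Fin.elim0, by simp⟩ ?_ ?_ hx
    · rintro _ ⟨⟨a, b⟩, rfl⟩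
      exact ⟨1, fun _ => a, fun _ => b, by simp⟩
    · rintro _ _ _ _ ⟨r, a, b, rfl⟩ ⟨r', a', b', rfl⟩
      refine ⟨r + r', Fin.append a a', Fin.append b b', ?_⟩
      rw [Fin.sum_univ_add]
      simp
    · rintro _ _ ⟨r, a, b, rfl⟩
      exact ⟨r, fun i => (a i)⁻¹, b, by simp [hinv]⟩
  obtain ⟨r, a, b, h⟩ := h1
  induction r with
  | zero => exact ⟨0, Nat.zero_le _, a, b, h⟩
  | succ r ih =>
    by_cases hr : r + 1 ≤ D / 2
    · exact ⟨r + 1, hr, a, b, h⟩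
    · obtain ⟨T, hT, h0⟩ := hdep (r + 1) (Sum.elim a b) (by omega)
      obtain ⟨a', b', hab⟩ := exists_shorter_sum B hmul hsymm hself a b T hT h0
      exact ih a' b' (h.trans hab)

/-! ### Rings generated by square classes -/

/-- The relations of a Witt ring `R` of a field that the argument uses: `R` is additively generated
by the classes `⟨a⟩` of one-dimensional forms, which are multiplicative in `a`, have square `1`, and
include `⟨-1⟩ = -1`. The ring homomorphism `dim` is the dimension index. -/
structure PresentedWittRing (G R : Type*) [CommGroup G] [CommRing R] where
  /-- The class of the one-dimensional form `⟨a⟩`. -/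
  u : G →* R
  /-- The group element that stands for `-1`. -/
  ν : G
  u_ν : u ν = -1
  u_mul_self (a : G) : u a * u a = 1
  closure_range_u : AddSubgroup.closure (Set.range u) = ⊤
  /-- The dimension index. -/
  dim : R →+* ZMod 2

namespace PresentedWittRing

variable {G R : Type*} [CommGroup G] [CommRing R] (W : PresentedWittRing G R)

/-- The class of the form `⟨1, -a⟩`. -/
def sym (a : G) : R := 1 - W.u a

/-- The ideal of classes of even-dimensional forms. -/
def I : Ideal R := RingHom.ker W.dim

theorem sym_mul (a b : G) : W.sym (a * b) = W.sym a + W.sym b - W.sym a * W.sym b := by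
  simp only [sym, map_mul]
  ring

theorem sym_one : W.sym 1 = 0 := by rw [sym, map_one, sub_self]

theorem sym_ν : W.sym W.ν = 2 := by
  rw [sym, W.u_ν]
  ring

theorem sym_mul_self (a : G) : W.sym a * W.sym a = 2 * W.sym a := by
  simp only [sym]
  linear_combination W.u_mul_self a

theorem sym_mem (a : G) : W.sym a ∈ W.I := by
  have h : W.dim (W.u a) * W.dim (W.u a) = 1 := by rw [← map_mul, W.u_mul_self, map_one]
  have h1 : ∀ z : ZMod 2, z * z = 1 → z = 1 := by decide
  rw [I, RingHom.mem_ker, sym, map_sub, map_one, h1 _ h, sub_self]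

theorem two_mem : (2 : R) ∈ W.I := W.sym_ν ▸ W.sym_mem W.ν

theorem two_pow_mem (m : ℕ) : (2 : R) ^ m ∈ W.I ^ m := Ideal.pow_mem_pow W.two_mem m

theorem mul_mem_pow {i j k : ℕ} (h : k ≤ i + j) {x y : R} (hx : x ∈ W.I ^ i) (hy : y ∈ W.I ^ j) :
    x * y ∈ W.I ^ k :=
  Ideal.pow_le_pow_right h (pow_add W.I i j ▸ Ideal.mul_mem_mul hx hy)

theorem mul_sym_mem {i : ℕ} {x : R} (hx : x ∈ W.I ^ i) (a : G) : x * W.sym a ∈ W.I ^ (i + 1) :=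
  W.mul_mem_pow le_rfl hx (by rw [pow_one]; exact W.sym_mem a)

/-- The set `Set.range W.sym ^ k` consists of the products of `k` symbols. -/
theorem symbols_subset (k : ℕ) : Set.range W.sym ^ k ⊆ ((W.I ^ k : Ideal R) : Set R) := by
  induction k with
  | zero => simp
  | succ k ih =>
    rw [pow_succ]
    rintro _ ⟨x, hx, _, ⟨a, rfl⟩, rfl⟩
    exact W.mul_sym_mem (ih hx) a

theorem two_pow_mem_symbols (m : ℕ) : (2 : R) ^ m ∈ Set.range W.sym ^ m :=
  Set.pow_mem_pow ⟨W.ν, W.sym_ν⟩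

theorem prod_mem_symbols {ι : Type*} (β : ι → G) (T : Finset ι) :
    ∏ i ∈ T, W.sym (β i) ∈ Set.range W.sym ^ T.card := by
  rw [← Finset.prod_const]
  exact Set.finsetProd_mem_finsetProd T _ _ fun i _ => ⟨β i, rfl⟩

theorem mem_closure_range_sym {x : R} (hx : x ∈ W.I) :
    x ∈ AddSubgroup.closure (Set.range W.sym) := by
  have h2 : (2 : R) ∈ AddSubgroup.closure (Set.range W.sym) :=
    AddSubgroup.subset_closure ⟨W.ν, W.sym_ν⟩
  -- modulo the symbols, every class is an integer, and its parity is the dimension index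
  have key : ∃ t : ℤ, x - t ∈ AddSubgroup.closure (Set.range W.sym) := by
    have hx : x ∈ AddSubgroup.closure (Set.range W.u) := W.closure_range_u ▸ AddSubgroup.mem_top x
    refine AddSubgroup.closure_induction ?_ ⟨0, by simp⟩ ?_ ?_ hx
    · rintro _ ⟨a, rfl⟩
      refine ⟨1, ?_⟩
      rw [← neg_mem_iff]
      exact AddSubgroup.subset_closure ⟨a, by simp [sym]⟩
    · rintro f g _ _ ⟨s, hs⟩ ⟨t, ht⟩
      refine ⟨s + t, ?_⟩
      convert add_mem hs ht using 1
      push_cast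
      ring
    · rintro f _ ⟨s, hs⟩
      refine ⟨-s, ?_⟩
      convert neg_mem hs using 1
      push_cast
      ring
  obtain ⟨t, ht⟩ := key
  have hle : AddSubgroup.closure (Set.range W.sym) ≤ W.I.toAddSubgroup := by
    rw [AddSubgroup.closure_le]
    rintro _ ⟨a, rfl⟩
    exact W.sym_mem a
  have h0 : W.dim (x - t) = 0 := hle ht
  have hx0 : W.dim x = 0 := hx
  rw [map_sub, hx0, map_intCast, zero_sub, neg_eq_zero] at h0
  obtain ⟨v, rfl⟩ := (ZMod.intCast_zmod_eq_zero_iff_dvd t 2).1 h0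
  have h3 := add_mem ht (AddSubgroup.zsmul_mem _ h2 v)
  rw [zsmul_eq_mul] at h3
  convert h3 using 1
  push_cast
  ring

/-- The power `Iᵏ` is additively generated by the classes of `k`-fold Pfister forms. -/
theorem mem_closure_symbols {k : ℕ} (hk : 1 ≤ k) {x : R} (hx : x ∈ W.I ^ k) :
    x ∈ AddSubgroup.closure (Set.range W.sym ^ k) := by
  induction k, hk using Nat.le_induction generalizing x with
  | base =>
    rw [pow_one] at hx ⊢
    exact W.mem_closure_range_sym hx
  | succ k hk ih =>
    rw [pow_succ] at hx
    refine Submodule.mul_induction_on hx (fun y hy z hz => ?_) fun y z hy hz => add_mem hy hz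
    refine AddSubgroup.closure_induction (fun y hy => ?_) (by rw [zero_mul]; exact zero_mem _)
      (fun a b _ _ h1 h2 => by rw [add_mul]; exact add_mem h1 h2)
      (fun a _ h => by rw [neg_mul]; exact neg_mem h) (ih hy)
    refine AddSubgroup.closure_induction (fun z hz => ?_) (by rw [mul_zero]; exact zero_mem _)
      (fun a b _ _ h1 h2 => by rw [mul_add]; exact add_mem h1 h2)
      (fun a _ h => by rw [mul_neg]; exact neg_mem h) (W.mem_closure_range_sym hz)
    rw [pow_succ]
    exact AddSubgroup.subset_closure (Set.mul_mem_mul hy hz)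

/-! ### Sums of symbols -/

/-- Modulo the ideal `J`, the element `x` is a sum of `k` classes of `n`-fold Pfister forms. -/
def IsSymbolSum (n : ℕ) (J : Ideal R) (k : ℕ) (x : R) : Prop :=
  ∃ π : Fin k → R, (∀ i, π i ∈ Set.range W.sym ^ n) ∧ x - ∑ i, π i ∈ J

variable {W} {n : ℕ} {J : Ideal R}

theorem isSymbolSum_zero {x : R} (hx : x ∈ J) : W.IsSymbolSum n J 0 x :=
  ⟨Fin.elim0, fun i => i.elim0, by simpa using hx⟩

theorem isSymbolSum_one {x y : R} (hy : y ∈ Set.range W.sym ^ n) (h : x - y ∈ J) :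
    W.IsSymbolSum n J 1 x :=
  ⟨fun _ => y, fun _ => hy, by simpa using h⟩

theorem IsSymbolSum.add {k l : ℕ} {x y : R} (hx : W.IsSymbolSum n J k x)
    (hy : W.IsSymbolSum n J l y) : W.IsSymbolSum n J (k + l) (x + y) := by
  obtain ⟨π, hπ, h⟩ := hx
  obtain ⟨ρ, hρ, h'⟩ := hy
  refine ⟨Fin.append π ρ, fun i => ?_, ?_⟩
  · induction i using Fin.addCases with
    | left i => simpa using hπ i
    | right i => simpa using hρ i
  · rw [Fin.sum_univ_add]
    simp only [Fin.append_left, Fin.append_right]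
    convert add_mem h h' using 1
    ring

theorem zero_mem_symbols (hn : 1 ≤ n) : (0 : R) ∈ Set.range W.sym ^ n := by
  obtain ⟨n, rfl⟩ := Nat.exists_eq_add_of_le' hn
  rw [pow_succ, ← mul_zero (W.sym 1 ^ n)]
  exact Set.mul_mem_mul (Set.pow_mem_pow ⟨1, rfl⟩) ⟨1, W.sym_one⟩

theorem IsSymbolSum.mono (hn : 1 ≤ n) {k l : ℕ} (hkl : k ≤ l) {x : R}
    (hx : W.IsSymbolSum n J k x) : W.IsSymbolSum n J l x := by
  obtain ⟨t, rfl⟩ := Nat.exists_eq_add_of_le hkl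
  have h : W.IsSymbolSum n J t 0 :=
    ⟨fun _ => 0, fun _ => zero_mem_symbols hn, by simp⟩
  simpa using hx.add h

theorem isSymbolSum_of_mem_iSup {κ : Type*} (s : Finset κ) (N : κ → AddSubgroup R) (w : κ → ℕ)
    (hN : ∀ i ∈ s, ∀ x ∈ N i, W.IsSymbolSum n J (w i) x) {x : R} (hx : x ∈ ⨆ i ∈ s, N i) :
    W.IsSymbolSum n J (∑ i ∈ s, w i) x := by
  classical
  induction s using Finset.induction_on generalizing x with
  | empty =>
    have hx0 : x = 0 := by simpa using hx
    exact isSymbolSum_zero (hx0 ▸ J.zero_mem)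
  | insert i s hi ih =>
    rw [Finset.iSup_insert, AddSubgroup.mem_sup] at hx
    obtain ⟨y, hy, z, hz, rfl⟩ := hx
    rw [Finset.sum_insert hi]
    exact (hN i (Finset.mem_insert_self i s) y hy).add
      (ih (fun j hj => hN j (Finset.mem_insert_of_mem hj)) hz)

end PresentedWittRing

namespace PresentedWittRing

variable {G R : Type*} [CommGroup G] [CommRing R] (W : PresentedWittRing G R)

/-! ### One step of the filtration by powers of two -/

/-- The ideal `2 ^ (m + 1) Iʲ + I ^ (m + j + 2)`: what is left for later when an element of
`2ᵐ I ^ (j + 1)` is approximated modulo `I ^ (m + j + 2)`. -/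
def stepIdeal (m j : ℕ) : Ideal R := Ideal.span {2 ^ (m + 1)} * W.I ^ j ⊔ W.I ^ (m + j + 2)

/-- The form `2ᵐ⟨1, -a⟩` vanishes. -/
def IsKilled (m : ℕ) (a : G) : Prop := 2 ^ m * W.sym a = 0

/-- The form `2ᵐ⟨1, -a⟩` or the form `2ᵐ⟨1, a⟩` vanishes. -/
def IsKilledUpToSign (m : ℕ) (a : G) : Prop := W.IsKilled m a ∨ W.IsKilled m (W.ν * a)

variable {W} {m j : ℕ}

theorem two_pow_succ_mul_mem {y : R} (hy : y ∈ W.I ^ j) : 2 ^ (m + 1) * y ∈ W.stepIdeal m j :=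
  Ideal.mem_sup_left (Ideal.mul_mem_mul (Ideal.mem_span_singleton_self _) hy)

theorem two_pow_mul_mem {y : R} (hy : y ∈ W.I ^ (j + 2)) : 2 ^ m * y ∈ W.stepIdeal m j :=
  Ideal.mem_sup_right (W.mul_mem_pow (by omega) (W.two_pow_mem m) hy)

/-- Modulo `stepIdeal`, multiplication of symbols by a fixed `2ᵐ y` is additive in the square
class. -/
def mulSym (m : ℕ) {y : R} (hy : y ∈ W.I ^ j) : Additive G →+ R ⧸ W.stepIdeal m j :=
  AddMonoidHom.mk' (fun a => Ideal.Quotient.mk _ (2 ^ m * (y * W.sym a.toMul))) fun a b => by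
    rw [← map_add, Ideal.Quotient.eq, toMul_add, sym_mul]
    have h : 2 ^ m * (y * W.sym a.toMul * W.sym b.toMul) ∈ W.stepIdeal m j :=
      two_pow_mul_mem (W.mul_sym_mem (W.mul_sym_mem hy _) _)
    convert neg_mem h using 1
    ring

theorem mulSym_ofMul {y : R} (hy : y ∈ W.I ^ j) (a : G) :
    mulSym m hy (Additive.ofMul a) = Ideal.Quotient.mk _ (2 ^ m * (y * W.sym a)) := rfl

theorem mulSym_eq_zero {y : R} (hy : y ∈ W.I ^ j) {a : G}
    (ha : W.IsKilledUpToSign m a) :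
    mulSym m hy (Additive.ofMul a) = 0 := by
  rw [mulSym_ofMul, Ideal.Quotient.eq_zero_iff_mem]
  rcases ha with (ha : 2 ^ m * W.sym a = 0) | (ha : 2 ^ m * W.sym (W.ν * a) = 0)
  · rw [mul_left_comm, ha, mul_zero]
    exact zero_mem _
  · rw [sym_mul, sym_ν] at ha
    have h : 2 ^ (m + 1) * (y * (W.sym a - 1)) ∈ W.stepIdeal m j :=
      two_pow_succ_mul_mem (Ideal.mul_mem_right _ _ hy)
    convert h using 1
    linear_combination y * ha

/-- If the `β i` generate `G` modulo elements killed by `2ᵐ` up to sign, then `2ᵐ I ^ (j + 1)` is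
spanned modulo `stepIdeal` by the squarefree monomials in the symbols of the `β i`. -/
theorem two_pow_mul_mem_of_monomials {ι : Type*} [DecidableEq ι] (β : ι → G)
    (hβ : ∀ a, ∃ T : Finset ι, W.IsKilledUpToSign m (a * ∏ i ∈ T, β i))
    (M : AddSubgroup R) (hM : (W.stepIdeal m j).toAddSubgroup ≤ M)
    (hmon : ∀ T : Finset ι, T.card = j + 1 → 2 ^ m * ∏ i ∈ T, W.sym (β i) ∈ M)
    {x : R} (hx : x ∈ W.I ^ (j + 1)) : 2 ^ m * x ∈ M := by
  -- expand an arbitrary product one factor at a time; repeated factors produce an extra `2`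
  have key : ∀ (l : ℕ) (T : Finset ι), T.card + l = j + 1 → ∀ x ∈ Set.range W.sym ^ l,
      2 ^ m * (x * ∏ i ∈ T, W.sym (β i)) ∈ M := by
    intro l
    induction l with
    | zero =>
      rintro T hT x hx
      rw [pow_zero, Set.mem_one] at hx
      rw [hx, one_mul]
      exact hmon T (by omega)
    | succ l ih =>
      intro T hT x hx
      rw [pow_succ] at hx
      obtain ⟨x, hx, _, ⟨a, rfl⟩, rfl⟩ := hx
      have hy : x * ∏ i ∈ T, W.sym (β i) ∈ W.I ^ j :=
        W.mul_mem_pow (by omega) (W.symbols_subset _ hx)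
          (W.symbols_subset _ (W.prod_mem_symbols β T))
      obtain ⟨S, hS⟩ := hβ a
      have h0 := mulSym_eq_zero hy hS
      rw [ofMul_mul, ofMul_prod, map_add, map_sum] at h0
      simp only [mulSym_ofMul] at h0
      rw [← map_sum, ← map_add, Ideal.Quotient.eq_zero_iff_mem] at h0
      have h1 : ∑ i ∈ S, 2 ^ m * (x * ∏ i ∈ T, W.sym (β i)) * W.sym (β i) ∈ M := by
        refine sum_mem fun i _ => ?_
        by_cases hi : i ∈ T
        · refine hM ?_
          have h2 : (∏ i ∈ T, W.sym (β i)) * W.sym (β i) = 2 * ∏ i ∈ T, W.sym (β i) := by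
            rw [← Finset.mul_prod_erase T _ hi]
            linear_combination (∏ i ∈ T.erase i, W.sym (β i)) * W.sym_mul_self (β i)
          have h3 := two_pow_succ_mul_mem (m := m) hy
          rw [Submodule.mem_toAddSubgroup]
          convert h3 using 1
          linear_combination 2 ^ m * x * h2
        · have h2 := ih (insert i T) (by rw [Finset.card_insert_of_notMem hi]; omega) x hx
          rw [Finset.prod_insert hi] at h2
          convert h2 using 1
          ring
      convert sub_mem (hM h0) h1 using 1
      simp only [← mul_assoc]
      ring
  refine AddSubgroup.closure_induction (fun x hx => ?_) (by rw [mul_zero]; exact zero_mem _)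
    (fun a b _ _ h1 h2 => by rw [mul_add]; exact add_mem h1 h2)
    (fun a _ h => by rw [mul_neg]; exact neg_mem h) (W.mem_closure_symbols (by omega) hx)
  simpa using key (j + 1) ∅ (by simp) x hx

theorem isSymbolSum_of_mem_closure_sym {y : R} (hy : y ∈ Set.range W.sym ^ j) {x : R}
    (hx : x ∈ AddSubgroup.closure (Set.range fun v => 2 ^ m * (y * W.sym v))) :
    W.IsSymbolSum (m + (j + 1)) (W.stepIdeal m j) 1 x := by
  have hy' := W.symbols_subset _ hy
  have h : ∃ v, Ideal.Quotient.mk (W.stepIdeal m j) x = mulSym m hy' v := by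
    refine AddSubgroup.closure_induction ?_ ⟨0, by simp⟩ ?_ ?_ hx
    · rintro _ ⟨v, rfl⟩
      exact ⟨Additive.ofMul v, rfl⟩
    · rintro _ _ _ _ ⟨v, hv⟩ ⟨w, hw⟩
      exact ⟨v + w, by rw [map_add, hv, hw, map_add]⟩
    · rintro _ _ ⟨v, hv⟩
      exact ⟨-v, by rw [map_neg, hv, map_neg]⟩
  obtain ⟨v, hv⟩ := h
  refine isSymbolSum_one (y := 2 ^ m * (y * W.sym v.toMul)) ?_ (Ideal.Quotient.eq.1 hv)
  rw [pow_add, pow_succ]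
  exact Set.mul_mem_mul (W.two_pow_mem_symbols m) (Set.mul_mem_mul hy ⟨_, rfl⟩)

theorem isSymbolSum_of_mem_closure_sym_mul_sym (D : ℕ)
    (hdep : ∀ (r : ℕ) (v : Fin r ⊕ Fin r → G), D < 2 * r → ∃ T : Finset (Fin r ⊕ Fin r),
      T.Nonempty ∧ W.IsKilledUpToSign m (∏ t ∈ T, v t))
    {y : R} (hy : y ∈ Set.range W.sym ^ j) {x : R}
    (hx : x ∈ AddSubgroup.closure
      (Set.range fun v : G × G => 2 ^ m * (y * W.sym v.1 * W.sym v.2))) :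
    W.IsSymbolSum (m + (j + 2)) (W.stepIdeal m (j + 1)) (D / 2) x := by
  have hy' := W.symbols_subset _ hy
  let B : G → G → R ⧸ W.stepIdeal m (j + 1) := fun v w =>
    Ideal.Quotient.mk _ (2 ^ m * (y * W.sym v * W.sym w))
  have hB : ∀ v w, B v w = mulSym m (W.mul_sym_mem hy' w) (Additive.ofMul v) := fun v w => by
    rw [mulSym_ofMul, mul_right_comm]
  have hx' : Ideal.Quotient.mk (W.stepIdeal m (j + 1)) x ∈
      AddSubgroup.closure (Set.range fun ab : G × G => B ab.1 ab.2) := by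
    have h := AddSubgroup.mem_map_of_mem
      (Ideal.Quotient.mk (W.stepIdeal m (j + 1))).toAddMonoidHom hx
    rw [AddMonoidHom.map_closure, ← Set.range_comp] at h
    exact h
  obtain ⟨r, hr, a, b, h⟩ := exists_sum_of_mem_closure B
    (fun a b c => by rw [hB, hB, hB, ofMul_mul, map_add])
    (fun a b => by
      change Ideal.Quotient.mk _ _ = Ideal.Quotient.mk _ _
      rw [mul_right_comm y])
    (fun a => by
      change Ideal.Quotient.mk _ _ = 0
      rw [Ideal.Quotient.eq_zero_iff_mem, mul_assoc y, W.sym_mul_self]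
      convert two_pow_succ_mul_mem (m := m) (W.mul_sym_mem hy' a) using 1
      ring) D
    (fun r v hr => by
      obtain ⟨T, hT, h⟩ := hdep r v hr
      refine ⟨T, hT, fun c => ?_⟩
      simp only [hB]
      rw [← map_sum, ← ofMul_prod]
      exact mulSym_eq_zero _ h) hx'
  refine IsSymbolSum.mono (by omega) hr ⟨fun i => 2 ^ m * (y * W.sym (a i) * W.sym (b i)),
    fun i => ?_, ?_⟩
  · rw [pow_add, pow_succ, pow_succ]
    exact Set.mul_mem_mul (W.two_pow_mem_symbols m)
      (Set.mul_mem_mul (Set.mul_mem_mul hy ⟨_, rfl⟩) ⟨_, rfl⟩)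
  · rw [← Ideal.Quotient.eq, h, map_sum]

/-- The number of symbols needed for `2ᵐ I ^ (j + 1)`. A squarefree monomial of degree `j + 1` in the
`p + q` symbols of the `β i` loses a factor so that it keeps an even number `2 * r` of factors among
the first `p`. The monomials that keep the same factors add up to one symbol. When `j = 2 * r + 1`,
only the `2 * r` factors among the first `p` are kept and two factors are dropped, which also covers
the monomials in the first `p` symbols alone; such a group is a sum of values of an alternating
map. -/
theorem isSymbolSum_two_pow_mul (p q D : ℕ) (hD : D / 2 ≤ q) (β : Fin p ⊕ Fin q → G)
    (hβ : ∀ a, ∃ T : Finset (Fin p ⊕ Fin q), W.IsKilledUpToSign m (a * ∏ i ∈ T, β i))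
    (hdep : ∀ (r : ℕ) (v : Fin r ⊕ Fin r → G), D < 2 * r → ∃ T : Finset (Fin r ⊕ Fin r),
      T.Nonempty ∧ W.IsKilledUpToSign m (∏ t ∈ T, v t))
    {x : R} (hx : x ∈ W.I ^ (j + 1)) :
    W.IsSymbolSum (m + (j + 1)) (W.stepIdeal m j)
      (∑ r ∈ Finset.range (j / 2 + 1), p.choose (2 * r) * q.choose (j - 2 * r)) (2 ^ m * x) := by
  let e : Finset (Fin p) → R := fun A => ∏ i ∈ A, W.sym (β (Sum.inl i))
  let f : Finset (Fin q) → R := fun B => ∏ i ∈ B, W.sym (β (Sum.inr i))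
  have he : ∀ A, e A ∈ Set.range W.sym ^ A.card := fun A => W.prod_mem_symbols _ A
  have hf : ∀ B, f B ∈ Set.range W.sym ^ B.card := fun B => W.prod_mem_symbols _ B
  -- `N₁` collects the groups that drop one factor, `N₂` those that drop two
  let N₁ : Finset (Fin p) × Finset (Fin q) → AddSubgroup R := fun AB =>
    AddSubgroup.closure (Set.range fun v => 2 ^ m * (e AB.1 * f AB.2 * W.sym v))
  let N₂ : Finset (Fin p) → AddSubgroup R := fun A =>
    AddSubgroup.closure (Set.range fun v : G × G => 2 ^ m * (e A * W.sym v.1 * W.sym v.2))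
  let N : ℕ → AddSubgroup R := fun r =>
    if j = 2 * r + 1 then ⨆ A ∈ Finset.powersetCard (2 * r) Finset.univ, N₂ A
    else ⨆ AB ∈ Finset.powersetCard (2 * r) Finset.univ ×ˢ
      Finset.powersetCard (j - 2 * r) Finset.univ, N₁ AB
  have hN : ∀ r ∈ Finset.range (j / 2 + 1), ∀ x ∈ N r, W.IsSymbolSum (m + (j + 1))
      (W.stepIdeal m j) (p.choose (2 * r) * q.choose (j - 2 * r)) x := by
    intro r hr x hx
    rw [Finset.mem_range] at hr
    simp only [N] at hx
    split_ifs at hx with hj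
    · have h := isSymbolSum_of_mem_iSup (W := W) (n := m + (j + 1)) (J := W.stepIdeal m j) _ N₂
        (fun _ => D / 2) (fun A hA z hz => ?_) hx
      · refine h.mono (by omega) ?_
        rw [Finset.sum_const, Finset.card_powersetCard, Finset.card_fin, smul_eq_mul,
          show j - 2 * r = 1 by omega, Nat.choose_one_right]
        exact Nat.mul_le_mul_left _ hD
      · subst hj
        refine isSymbolSum_of_mem_closure_sym_mul_sym D hdep ?_ hz
        have h := he A
        rwa [(Finset.mem_powersetCard.1 hA).2] at h
    · have h := isSymbolSum_of_mem_iSup (W := W) (n := m + (j + 1)) (J := W.stepIdeal m j) _ N₁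
        (fun _ => 1) (fun AB hAB z hz => ?_) hx
      · simpa using h
      · rw [Finset.mem_product, Finset.mem_powersetCard, Finset.mem_powersetCard] at hAB
        refine isSymbolSum_of_mem_closure_sym ?_ hz
        have h := Set.mul_mem_mul (he AB.1) (hf AB.2)
        rw [← pow_add, hAB.1.2, hAB.2.2, Nat.add_sub_cancel' (by omega)] at h
        exact h
  have hmem : ∀ r ∈ Finset.range (j / 2 + 1), N r ≤ ⨆ r ∈ Finset.range (j / 2 + 1), N r :=
    fun r hr => le_biSup N hr
  have two_dropped : ∀ (r : ℕ) (A : Finset (Fin p)) (v w : G), A.card = 2 * r → j = 2 * r + 1 →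
      2 ^ m * (e A * W.sym v * W.sym w) ∈ ⨆ r ∈ Finset.range (j / 2 + 1), N r := by
    intro r A v w hA hj
    refine hmem r (Finset.mem_range.2 (by omega)) ?_
    simp only [N, if_pos hj]
    have hA' : A ∈ Finset.powersetCard (2 * r) Finset.univ :=
      Finset.mem_powersetCard.2 ⟨Finset.subset_univ A, hA⟩
    exact le_biSup N₂ hA' (AddSubgroup.subset_closure ⟨(v, w), rfl⟩)
  have one_dropped : ∀ (r : ℕ) (A : Finset (Fin p)) (B : Finset (Fin q)) (v : G),
      A.card = 2 * r → A.card + B.card = j →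
      2 ^ m * (e A * f B * W.sym v) ∈ ⨆ r ∈ Finset.range (j / 2 + 1), N r := by
    intro r A B v hA hAB
    by_cases hj : j = 2 * r + 1
    · obtain ⟨b, rfl⟩ := Finset.card_eq_one.1 (show B.card = 1 by omega)
      have hb : f {b} = W.sym (β (Sum.inr b)) := Finset.prod_singleton _ _
      rw [hb]
      exact two_dropped r A _ v hA hj
    · refine hmem r (Finset.mem_range.2 (by omega)) ?_
      simp only [N, if_neg hj]
      have hAB' : (A, B) ∈ Finset.powersetCard (2 * r) Finset.univ ×ˢ
          Finset.powersetCard (j - 2 * r) Finset.univ :=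
        Finset.mem_product.2 ⟨Finset.mem_powersetCard.2 ⟨Finset.subset_univ A, hA⟩,
          Finset.mem_powersetCard.2 ⟨Finset.subset_univ B, show B.card = _ by omega⟩⟩
      exact le_biSup N₁ hAB' (AddSubgroup.subset_closure ⟨v, rfl⟩)
  have hmain := two_pow_mul_mem_of_monomials β hβ
    ((⨆ r ∈ Finset.range (j / 2 + 1), N r) ⊔ (W.stepIdeal m j).toAddSubgroup) le_sup_right
    (fun T hT => AddSubgroup.mem_sup_left ?_) hx
  · obtain ⟨y, hy, z, hz, hyz⟩ := AddSubgroup.mem_sup.1 hmain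
    rw [← hyz, ← add_zero (∑ r ∈ _, _)]
    exact (isSymbolSum_of_mem_iSup _ N _ hN hy).add (isSymbolSum_zero hz)
  · have hcard := Finset.card_toLeft_add_card_toRight (u := T)
    have hprod : ∏ i ∈ T, W.sym (β i) = e T.toLeft * f T.toRight := by
      have h := Finset.prod_disjSum T.toLeft T.toRight fun i => W.sym (β i)
      rwa [Finset.toLeft_disjSum_toRight] at h
    rw [hprod]
    rw [hT] at hcard
    generalize T.toLeft = A at hcard
    generalize T.toRight = B at hcard
    have he_erase : ∀ {A : Finset (Fin p)} {a}, a ∈ A →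
        e A = e (A.erase a) * W.sym (β (Sum.inl a)) := fun h => (Finset.prod_erase_mul _ _ h).symm
    have hf_erase : ∀ {b}, b ∈ B → f B = f (B.erase b) * W.sym (β (Sum.inr b)) :=
      fun h => (Finset.prod_erase_mul _ _ h).symm
    rcases Nat.even_or_odd' A.card with ⟨r, hr | hr⟩
    · rcases B.eq_empty_or_nonempty with rfl | ⟨b, hb⟩
      · have hA : 1 < A.card := by
          rw [Finset.card_empty] at hcard
          omega
        obtain ⟨a, ha, a', ha', hne⟩ := Finset.one_lt_card.1 hA
        have ha'' : a' ∈ A.erase a := Finset.mem_erase.2 ⟨hne.symm, ha'⟩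
        have h1 := Finset.card_erase_of_mem ha
        have h2 := Finset.card_erase_of_mem ha''
        rw [Finset.card_empty] at hcard
        rw [he_erase ha, he_erase ha'', show f ∅ = 1 from Finset.prod_empty, mul_one]
        exact two_dropped (r - 1) ((A.erase a).erase a') _ _ (by omega) (by omega)
      · have h1 := Finset.card_erase_add_one hb
        rw [hf_erase hb, ← mul_assoc (e A)]
        exact one_dropped r A (B.erase b) _ hr (by omega)
    · obtain ⟨a, ha⟩ := Finset.card_pos.1 (show 0 < A.card by omega)
      have h1 := Finset.card_erase_add_one ha
      rw [he_erase ha, mul_right_comm]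
      exact one_dropped r (A.erase a) B _ (by omega) (by omega)

end PresentedWittRing

namespace PresentedWittRing

variable {G R : Type*} [CommGroup G] [CommRing R] {W : PresentedWittRing G R}

/-! ### Iterating the step -/

/-- If `b m j` symbols suffice for `2ᵐ I ^ (j + 1)` modulo `stepIdeal`, then after `t` steps an
element of `Iⁿ` is approximated up to an element of `2ᵗ I ^ (n - t)`. -/
theorem isSymbolSum_of_mem_two_pow_mul (b : ℕ → ℕ → ℕ)
    (hstep : ∀ m j x, x ∈ W.I ^ (j + 1) →
      W.IsSymbolSum (m + (j + 1)) (W.stepIdeal m j) (b m j) (2 ^ m * x))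
    {n : ℕ} {φ : R} (hφ : φ ∈ W.I ^ n) (t : ℕ) (ht : t ≤ n - 1) :
    ∃ y ∈ W.I ^ (n - t), W.IsSymbolSum n (W.I ^ (n + 1))
      (∑ m ∈ Finset.range t, b m (n - m - 1)) (φ - 2 ^ t * y) := by
  induction t with
  | zero => exact ⟨φ, hφ, isSymbolSum_zero (by simp)⟩
  | succ t ih =>
    obtain ⟨y, hy, h⟩ := ih (by omega)
    obtain ⟨j, rfl⟩ : ∃ j, n = t + (j + 2) := ⟨n - t - 2, by omega⟩
    rw [show t + (j + 2) - t = j + 1 + 1 by omega] at hy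
    obtain ⟨π, hπ, hπ'⟩ := hstep t (j + 1) y hy
    obtain ⟨z, hz, w, hw, hzw⟩ := Submodule.mem_sup.1 hπ'
    obtain ⟨y', hy', rfl⟩ := Ideal.mem_span_singleton_mul.1 hz
    refine ⟨y', by rwa [show t + (j + 2) - (t + 1) = j + 1 by omega], ?_⟩
    rw [Finset.sum_range_succ, show t + (j + 2) - t - 1 = j + 1 by omega]
    have h2 : W.IsSymbolSum (t + (j + 2)) (W.I ^ (t + (j + 2) + 1)) (b t (j + 1))
        (2 ^ t * y - 2 ^ (t + 1) * y') := by
      refine ⟨π, hπ, ?_⟩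
      have h3 : 2 ^ t * y - 2 ^ (t + 1) * y' - ∑ i, π i = w := by linear_combination -hzw
      rw [h3]
      exact hw
    convert h.add h2 using 1
    ring

/-- The last step: an element of `2ᵐ I` is a single symbol modulo `I ^ (m + 2)`. -/
theorem isSymbolSum_two_pow_mul_of_mem_I (m : ℕ) {y : R} (hy : y ∈ W.I) :
    W.IsSymbolSum (m + 1) (W.I ^ (m + 2)) 1 (2 ^ m * y) := by
  have h : ∃ a, y - W.sym a ∈ W.I ^ 2 := by
    refine AddSubgroup.closure_induction ?_ ⟨1, by simp [sym_one]⟩ ?_ ?_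
      (W.mem_closure_range_sym hy)
    · rintro _ ⟨a, rfl⟩
      exact ⟨a, by simp⟩
    · rintro y z _ _ ⟨a, ha⟩ ⟨b, hb⟩
      refine ⟨a * b, ?_⟩
      have h : W.sym a * W.sym b ∈ W.I ^ 2 := sq W.I ▸ Ideal.mul_mem_mul (W.sym_mem a) (W.sym_mem b)
      convert add_mem (add_mem ha hb) h using 1
      rw [sym_mul]
      ring
    · rintro y _ ⟨a, ha⟩
      refine ⟨a, ?_⟩
      have h : W.sym a * 2 ∈ W.I ^ 2 := sq W.I ▸ Ideal.mul_mem_mul (W.sym_mem a) W.two_mem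
      convert neg_mem (add_mem ha h) using 1
      ring
  obtain ⟨a, ha⟩ := h
  refine isSymbolSum_one (y := 2 ^ m * W.sym a) ?_ ?_
  · rw [pow_succ]
    exact Set.mul_mem_mul (W.two_pow_mem_symbols m) ⟨a, rfl⟩
  · rw [← mul_sub]
    exact W.mul_mem_pow le_rfl (W.two_pow_mem m) ha

theorem isKilled_of_two_pow_mul {m : ℕ} {a : G} (h : 2 ^ m * W.u a = 2 ^ m) :
    W.IsKilled m a := by
  rw [IsKilled, sym, mul_sub, h, mul_one, sub_self]

/-- Since `⟨1, -a⟩` is itself a one-fold Pfister form, a product of symbols is a Pfister class. -/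
theorem exists_eq_pfister {n : ℕ} {x : R} (hx : x ∈ Set.range W.sym ^ n) :
    ∃ a : Fin n → G, x = W.u 1 * ∏ i, (W.u 1 + W.u (a i)) := by
  obtain ⟨f, rfl⟩ := Set.mem_pow.1 hx
  choose a ha using fun i => (f i).2
  refine ⟨fun i => W.ν * a i, ?_⟩
  rw [map_one, one_mul, List.prod_ofFn]
  refine Finset.prod_congr rfl fun i _ => ?_
  rw [← ha, sym, map_mul, W.u_ν, neg_one_mul, sub_eq_add_neg]

/-- The bound for `Iⁿ`, given the dimension `D m` of the group of square classes modulo those that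
`2ᵐ` annihilates up to sign. -/
theorem isSymbolSum_of_mem_pow (D : ℕ → ℕ)
    (hβ : ∀ m, ∃ β : Fin (D m / 2) ⊕ Fin ((D m + 1) / 2) → G, ∀ a, ∃ T : Finset _,
      W.IsKilledUpToSign m (a * ∏ i ∈ T, β i))
    (hdep : ∀ (m r : ℕ) (v : Fin r ⊕ Fin r → G), D m < 2 * r → ∃ T : Finset (Fin r ⊕ Fin r),
      T.Nonempty ∧ W.IsKilledUpToSign m (∏ t ∈ T, v t))
    {n : ℕ} (hn : 1 ≤ n) {φ : R} (hφ : φ ∈ W.I ^ n) (k : ℕ)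
    (hk : k = n ∨ ∃ s, k = s + 1 ∧ s < n - 1 ∧ W.IsKilled s W.ν) :
    W.IsSymbolSum n (W.I ^ (n + 1)) (∑ m ∈ Finset.range k, ∑ r ∈ Finset.range ((n - m - 1) / 2 + 1),
      (D m / 2).choose (2 * r) * ((D m + 1) / 2).choose (n - m - 1 - 2 * r)) φ := by
  have h := isSymbolSum_of_mem_two_pow_mul (fun m j => ∑ r ∈ Finset.range (j / 2 + 1),
    (D m / 2).choose (2 * r) * ((D m + 1) / 2).choose (j - 2 * r)) (fun m j x hx => by
      obtain ⟨β, hβ⟩ := hβ m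
      exact isSymbolSum_two_pow_mul _ _ (D m) (by omega) β hβ (hdep m) hx) hφ
  rcases hk with rfl | ⟨s, rfl, hs, h0⟩
  · obtain ⟨n, rfl⟩ := Nat.exists_eq_add_of_le' hn
    obtain ⟨y, hy, hy'⟩ := h n (by simp)
    rw [Nat.add_sub_cancel_left, pow_one] at hy
    rw [Finset.sum_range_succ]
    have h1 := hy'.add (isSymbolSum_two_pow_mul_of_mem_I n hy)
    rw [sub_add_cancel] at h1
    simpa using h1
  · obtain ⟨y, hy, hy'⟩ := h (s + 1) hs
    rw [IsKilled, sym_ν, ← pow_succ] at h0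
    rwa [h0, zero_mul, sub_zero] at hy'

end PresentedWittRing

/-! ### The Witt ring of a field -/

section

variable (F : Type*) [Field F]

theorem closure_range_unary : AddSubgroup.closure (Set.range (unary F)) = ⊤ := by
  refine top_unique fun x _ => ?_
  obtain ⟨y, rfl⟩ := Ideal.Quotient.mk_surjective x
  induction y using MonoidAlgebra.induction_on with
  | of a => exact AddSubgroup.subset_closure ⟨a, rfl⟩
  | add f g hf hg =>
    rw [map_add]
    exact add_mem (hf trivial) (hg trivial)
  | smul r f hf =>
    rw [map_zsmul]
    exact AddSubgroup.zsmul_mem _ (hf trivial) r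

theorem unary_neg_one : unary F (-1) = -1 := by
  have h : formalClass F ![1, -1] ∈ wittIdeal F := Ideal.subset_span (Or.inr rfl)
  rw [← Ideal.Quotient.eq_zero_iff_mem, formalClass, Fin.sum_univ_two, map_add] at h
  exact eq_neg_of_add_eq_zero_right h

open Matrix in
/-- The form `2ᵐ⟨1⟩` is round: it is isometric to `2ᵐ⟨a⟩` when it represents `a`. -/
theorem two_pow_mul_unary {m : ℕ} {a : Fˣ} (ha : a ∈ sumSqSubgroup F m) :
    2 ^ m * unary F a = 2 ^ m := by
  obtain ⟨x, hx⟩ := ha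
  obtain ⟨C, hC⟩ := exists_similitude F m x
  rw [← hx] at hC
  -- the similitude `C` with multiplier `a` is the isometry from `2ᵐ⟨a⟩` to `2ᵐ⟨1⟩`
  have h1 : ((a : F)⁻¹ • Cᵀ) * C = 1 := by
    rw [smul_mul, hC, smul_smul, inv_mul_cancel₀ a.ne_zero, one_smul]
  have h2 := mul_eq_one_comm.1 h1
  have key : (diagForm F fun _ : Fin (2 ^ m) => a).Equivalent
      (diagForm F fun _ : Fin (2 ^ m) => (1 : Fˣ)) := by
    refine ⟨⟨Matrix.toLin'OfInv h1 h2, fun y => ?_⟩⟩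
    have h3 : (C *ᵥ y) ⬝ᵥ (C *ᵥ y) = (a : F) * (y ⬝ᵥ y) := by
      rw [Matrix.dotProduct_mulVec, ← Matrix.mulVec_transpose, Matrix.mulVec_mulVec, hC,
        Matrix.smul_mulVec, Matrix.one_mulVec, smul_dotProduct, smul_eq_mul]
    have h4 : (diagForm F fun _ : Fin (2 ^ m) => (1 : Fˣ)) (C *ᵥ y) = (C *ᵥ y) ⬝ᵥ (C *ᵥ y) := by
      simp [diagForm, QuadraticMap.weightedSumSquares_apply, dotProduct]
    have h5 : (diagForm F fun _ : Fin (2 ^ m) => a) y = (a : F) * (y ⬝ᵥ y) := by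
      simp [diagForm, QuadraticMap.weightedSumSquares_apply, dotProduct, Finset.mul_sum]
    rw [h5, ← h3, ← h4]
    rfl
  have hmem : formalClass F (fun _ : Fin (2 ^ m) => a) - formalClass F (fun _ : Fin (2 ^ m) => 1)
      ∈ wittIdeal F := Ideal.subset_span (Or.inl ⟨_, _, _, key, rfl⟩)
  have h6 : ∀ v : Fˣ, formalClass F (fun _ : Fin (2 ^ m) => v) =
      2 ^ m * MonoidAlgebra.of ℤ Fˣ v := fun v => by
    rw [formalClass, Finset.sum_const, Finset.card_fin, nsmul_eq_mul]
    push_cast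
    rfl
  rw [h6, h6, map_one, mul_one] at hmem
  have h7 := Ideal.Quotient.eq.2 hmem
  rw [map_mul, map_pow, map_ofNat] at h7
  exact h7

theorem unary_mul_self (a : Fˣ) : unary F a * unary F a = 1 := by
  have h : a * a ∈ sumSqSubgroup F 0 := ⟨fun _ => a, by simp [sq]⟩
  have h1 := two_pow_mul_unary F h
  rw [pow_zero] at h1
  calc unary F a * unary F a = unary F (a * a) := by
        simp only [unary]
        rw [map_mul, map_mul]
    _ = 1 := (one_mul _).symm.trans h1

/-- The Witt ring of a field, with its one-dimensional classes, satisfies the relations. -/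
noncomputable def presentedWittRing : PresentedWittRing Fˣ (WittRing F) where
  u := (Ideal.Quotient.mk (wittIdeal F)).toMonoidHom.comp (MonoidAlgebra.of ℤ Fˣ)
  ν := -1
  u_ν := unary_neg_one F
  u_mul_self := unary_mul_self F
  closure_range_u := closure_range_unary F
  dim := dimMod2 F

theorem isKilledUpToSign_of_mem {m : ℕ} {a : Fˣ} (ha : a ∈ pmSumSqSubgroup F m) :
    (presentedWittRing F).IsKilledUpToSign m a := by
  have h : ∀ b ∈ sumSqSubgroup F m, (presentedWittRing F).IsKilled m b := fun b hb =>
    PresentedWittRing.isKilled_of_two_pow_mul (W := presentedWittRing F) (two_pow_mul_unary F hb)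
  refine ha.imp (h a) fun ha => h _ ?_
  rw [show (presentedWittRing F).ν = -1 from rfl, neg_one_mul]
  exact ha

/-- The class of a unit in `Fˣ / ±D(2ᵐ)`. -/
def modPmClass (m : ℕ) : Additive Fˣ →+ ModPmSumSq F m :=
  AddMonoidHom.mk' (fun a => Additive.ofMul (QuotientGroup.mk a.toMul : Fˣ ⧸ pmSumSqSubgroup F m))
    fun _ _ => rfl

theorem modPmClass_surjective (m : ℕ) : Function.Surjective (modPmClass F m) := fun x => by
  induction x using Additive.rec with
  | ofMul x =>
    induction x using QuotientGroup.induction_on with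
    | H u => exact ⟨Additive.ofMul u, rfl⟩

theorem mem_of_modPmClass_eq_zero {m : ℕ} {a : Fˣ} (h : modPmClass F m (Additive.ofMul a) = 0) :
    a ∈ pmSumSqSubgroup F m :=
  (QuotientGroup.eq_one_iff a).1 (congrArg Additive.toMul h)

theorem smul_eq_ite {V : Type*} [AddCommGroup V] [Module (ZMod 2) V] (c : ZMod 2) (v : V) :
    c • v = if c ≠ 0 then v else 0 := by
  have h : ∀ c : ZMod 2, c ≠ 0 → c = 1 := by decide
  split_ifs with hc
  · rw [h c hc, one_smul]
  · rw [not_not.1 hc, zero_smul]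

theorem finite_modPmSumSq {d : ℕ} (hd : Nat.card (Fˣ ⧸ Subgroup.square Fˣ) = 2 ^ d) (m : ℕ) :
    Finite (ModPmSumSq F m) := by
  have h1 : Finite (Fˣ ⧸ Subgroup.square Fˣ) := Nat.finite_of_card_ne_zero (by rw [hd]; positivity)
  have h2 : Subgroup.square Fˣ ≤ pmSumSqSubgroup F m := by
    rintro u hu
    obtain ⟨v, rfl⟩ := Subgroup.mem_square.1 hu
    exact sq v ▸ sq_mem_pmSumSqSubgroup F m v
  have h3 : (Subgroup.square Fˣ).FiniteIndex := Subgroup.finiteIndex_of_finite_quotient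
  have h4 := Subgroup.finiteIndex_of_le h2
  exact inferInstanceAs (Finite (Fˣ ⧸ pmSumSqSubgroup F m))

/-- A basis of `Fˣ / ±D(2ᵐ)` lifts to units, indexed here by two halves. -/
theorem exists_basis_lift {m : ℕ} [Finite (ModPmSumSq F m)] :
    ∃ β : Fin (dimModPm F m / 2) ⊕ Fin ((dimModPm F m + 1) / 2) → Fˣ,
      ∀ a, ∃ T : Finset _, a * ∏ i ∈ T, β i ∈ pmSumSqSubgroup F m := by
  let b := Module.finBasis (ZMod 2) (ModPmSumSq F m)
  let e : Fin (dimModPm F m / 2) ⊕ Fin ((dimModPm F m + 1) / 2) ≃ Fin (dimModPm F m) :=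
    finSumFinEquiv.trans (finCongr (by omega))
  choose β hβ using fun i => modPmClass_surjective F m (b (e i))
  refine ⟨fun i => (β i).toMul, fun a => ?_⟩
  refine ⟨Finset.univ.filter fun i => b.repr (modPmClass F m (Additive.ofMul a)) (e i) ≠ 0,
    mem_of_modPmClass_eq_zero F ?_⟩
  rw [ofMul_mul, ofMul_prod, map_add, map_sum]
  simp only [ofMul_toMul, hβ]
  rw [Finset.sum_filter]
  simp only [← smul_eq_ite]
  rw [e.sum_comp fun i => b.repr (modPmClass F m (Additive.ofMul a)) i • b i]
  change _ + ∑ i : Fin (Module.finrank (ZMod 2) (ModPmSumSq F m)), _ = _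
  rw [b.sum_repr, ← two_nsmul, two_nsmul_modPmSumSq]

/-- Linear dependence of more than `d_m` units in `Fˣ / ±D(2ᵐ)`, written multiplicatively. -/
theorem exists_prod_mem {m : ℕ} [Finite (ModPmSumSq F m)] {ι : Type*} [Fintype ι]
    (v : ι → Fˣ) (hv : dimModPm F m < Fintype.card ι) :
    ∃ T : Finset ι, T.Nonempty ∧ ∏ t ∈ T, v t ∈ pmSumSqSubgroup F m := by
  have h : ¬LinearIndependent (ZMod 2) fun i => modPmClass F m (Additive.ofMul (v i)) :=
    fun h => absurd h.fintype_card_le_finrank (not_le.2 hv)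
  obtain ⟨g, hg, i, hi⟩ := Fintype.not_linearIndependent_iff.1 h
  refine ⟨Finset.univ.filter fun i => g i ≠ 0, ⟨i, by simpa using hi⟩,
    mem_of_modPmClass_eq_zero F ?_⟩
  refine Eq.trans ?_ hg
  rw [ofMul_prod, map_sum, Finset.sum_filter]
  exact Finset.sum_congr rfl fun i _ => (smul_eq_ite _ _).symm

theorem exists_sum_sq_of_level {s : ℕ} (h : level F = ((2 ^ s : ℕ) : ℕ∞)) :
    (-1 : Fˣ) ∈ sumSqSubgroup F s := by
  have hlt : level F < ((2 ^ s + 1 : ℕ) : ℕ∞) := by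
    rw [h]
    exact_mod_cast Nat.lt_succ_self _
  obtain ⟨k, hk⟩ := iInf_lt_iff.1 hlt
  obtain ⟨⟨x, hx⟩, hk⟩ := iInf_lt_iff.1 hk
  have hle : level F ≤ k := iInf₂_le k ⟨x, hx⟩
  rw [h] at hle
  have hk' : k = 2 ^ s := le_antisymm (Nat.lt_succ_iff.1 (by exact_mod_cast hk))
    (by exact_mod_cast hle)
  subst hk'
  exact ⟨x, by rw [← hx, Units.val_neg, Units.val_one]⟩

theorem symbolLength_le {n k : ℕ} {φ : WittRing F}
    (h : (presentedWittRing F).IsSymbolSum n ((presentedWittRing F).I ^ (n + 1)) k φ) :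
    symbolLength F n φ ≤ k := by
  obtain ⟨π, hπ, h⟩ := h
  refine iInf₂_le k ⟨π, fun i => ?_, h⟩
  obtain ⟨a, ha⟩ := PresentedWittRing.exists_eq_pfister (hπ i)
  exact ⟨1, a, ha⟩

theorem fieldSymbolLength_le {d : ℕ} (hd : Nat.card (Fˣ ⧸ Subgroup.square Fˣ) = 2 ^ d) {n : ℕ}
    (hn : 1 ≤ n) (k : ℕ)
    (hk : k = n ∨ ∃ s, k = s + 1 ∧ s < n - 1 ∧ (presentedWittRing F).IsKilled s (-1)) :
    fieldSymbolLength F n ≤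
      ((∑ m ∈ Finset.range k, ∑ r ∈ Finset.range ((n - m - 1) / 2 + 1),
        (dimModPm F m / 2).choose (2 * r) *
          ((dimModPm F m + 1) / 2).choose (n - m - 1 - 2 * r) : ℕ) : ℕ∞) := by
  have hfin := finite_modPmSumSq F hd
  refine iSup₂_le fun φ hφ => symbolLength_le F ?_
  have hφ' : φ ∈ (presentedWittRing F).I ^ n := hφ
  refine PresentedWittRing.isSymbolSum_of_mem_pow (W := presentedWittRing F) (dimModPm F) ?_ ?_
    hn hφ' k hk
  · intro m
    obtain ⟨β, hβ⟩ := exists_basis_lift F (m := m)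
    exact ⟨β, fun a => (hβ a).imp fun T hT => isKilledUpToSign_of_mem F hT⟩
  · intro m r v hr
    obtain ⟨T, hT, h⟩ := exists_prod_mem F v (by simpa [two_mul] using hr)
    exact ⟨T, hT, isKilledUpToSign_of_mem F h⟩

theorem isKilled_neg_one_of_level {s : ℕ} (h : level F = ((2 ^ s : ℕ) : ℕ∞)) :
    (presentedWittRing F).IsKilled s (-1) :=
  PresentedWittRing.isKilled_of_two_pow_mul (two_pow_mul_unary F (exists_sum_sq_of_level F h))

end

end SymbolLength

theorem mainTheorem1 (F : Type*) [Field F] (h2 : (2 : F) ≠ 0) (d : ℕ)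
    (hd : Nat.card (Fˣ ⧸ Subgroup.square Fˣ) = 2 ^ d) (n : ℕ) (hn : 1 ≤ n) :
    (∀ s : ℕ, SymbolLength.level F = ((2 ^ s : ℕ) : ℕ∞) →
      SymbolLength.fieldSymbolLength F n ≤
        ((∑ m ∈ Finset.range (min s (n - 1) + 1), ∑ r ∈ Finset.range ((n - m - 1) / 2 + 1),
          (SymbolLength.dimModPm F m / 2).choose (2 * r) *
            ((SymbolLength.dimModPm F m + 1) / 2).choose (n - m - 1 - 2 * r) : ℕ) : ℕ∞)) ∧
    (IsFormallyReal F →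
      SymbolLength.fieldSymbolLength F n ≤
        ((∑ m ∈ Finset.range n, ∑ r ∈ Finset.range ((n - m - 1) / 2 + 1),
          (SymbolLength.dimModPm F m / 2).choose (2 * r) *
            ((SymbolLength.dimModPm F m + 1) / 2).choose (n - m - 1 - 2 * r) : ℕ) : ℕ∞)) := by
  refine ⟨fun s hs => SymbolLength.fieldSymbolLength_le F hd hn _ ?_,
    fun _ => SymbolLength.fieldSymbolLength_le F hd hn n (Or.inl rfl)⟩
  rcases Nat.lt_or_ge s (n - 1) with h | h
  · rw [min_eq_left h.le]
    exact Or.inr ⟨s, rfl, h, SymbolLength.isKilled_neg_one_of_level F hs⟩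
  · rw [min_eq_right h]
    exact Or.inl (Nat.sub_add_cancel hn)
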